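/- Norms are the normalized norms of $L_p(0,2\pi)$: $\|f\|_1=\frac1{2\pi}\int_0^{2\pi}|f(x)|\,dx$, and $\|f\|_\infty$ is the essential supremum of $|f|$ on $(0,2\pi)$. There are absolute constants $\alpha,\beta,\gamma>0$ such that the following holds. Let $q>1$, let $\{m_j\}_{j=1}^\infty$ be a sequence of positive integers with $m_{j+1}/m_j\ge q$ for all $j\ge1$, and let $\{d_j\}_{j=1}^\infty$ be a sequence of integers with $1\le d_j\le m_{j+1}-m_j$ for all $j\ge 1$. Then there is a sequence of trigonometric polynomials $\{\delta_j\}_{j=1}^\infty$ of the form $$\delta_j(x)=\sum_{m_j\le s<m_j+d_j}c_s e^{isx},\qquad c_s\in\mathbb R,$$ such that for all $j\ge1$ $$\frac18\le\|\delta_j\|_1\le\|\delta_j\|_\infty\le 7,$$ and for all $N=1,2,\dots$ $$\Big\|\sum_{j=1}^N\delta_j\Big\|_\infty\le\alpha+\beta\sqrt N+\gamma\max_{1\le j\le N}\log_q\max\Big(\frac{m_j}{d_j},\frac1{\ln q},1\Big).$$ -/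

import Mathlib

open MeasureTheory

/-- Lebesgue measure on `(0, 2π)`, normalized to total mass `1`. The norms `‖f‖_p` of
`L_p(0, 2π)` are the (extended-real valued) norms `eLpNorm f p circleMeasure`. -/
noncomputable def circleMeasure : Measure ℝ :=
  (ENNReal.ofReal (2 * Real.pi))⁻¹ • volume.restrict (Set.Ioo 0 (2 * Real.pi))

/-- The function `f : ℝ → ℂ` is a trigonometric polynomial with real coefficients whose
frequencies lie in `[m, m + d)`, i.e. `f x = ∑_{m ≤ s < m + d} c_s e^{isx}` with real `c_s`. -/
def IsTrigPolyOn (m d : ℕ) (f : ℝ → ℂ) : Prop :=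
  ∃ c : ℕ → ℝ, ∀ x : ℝ,
    f x = ∑ s ∈ Finset.Ico m (m + d), (c s : ℂ) * Complex.exp (Complex.I * (s : ℂ) * (x : ℂ))

/-! Write S_k for the sum of δ_1, …, δ_k. The j-th block is switched off wherever an earlier partial
sum is already large: its target amplitude is max(0, 1 - |S|/(2√j)), where S = S_{j-r_j} for a delay
r_j. A Fejér-type kernel of degree about d_j/2 smooths this amplitude, and modulation moves the
result into the window [m_j, m_j + d_j).

The L¹ bound: the earlier blocks are orthogonal and bounded by 1, so the mean of |S|² is at most j
and the amplitude has mean at least 1/2 (`half_le_gridMean_cutoff`). Smoothing preserves this mean,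
which appears as the Fourier coefficient of δ_j at the modulating frequency (`exists_block`).

The sup bound: where |S| < 2√j, the current sum is at most 2√j + r_j; elsewhere δ_j is only a
smoothing error (`norm_sum_le_of_delayed`). That error is of order (Lipschitz constant of S)/d_j. By
lacunarity a delay of about 2 log_q(X_j j), with X_j = max(m_j/d_j, 1/ln q, 1), makes it O(j⁻²),
which is summable (`delay_error_le`). The term log_q j in the delay is absorbed by √N and log_q X_1
(`logb_nat_le`).

Amplitudes are averaged over a grid of m_j + d_j points, where Parseval is exact for all frequencies
involved. -/

/-! ### Means over a uniform grid and discrete Parseval -/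

/-- The `l`-th point of the uniform grid of `M` points on the circle. -/
noncomputable def gridPoint (M l : ℕ) : ℝ := 2 * Real.pi * l / M

/-- The mean of `g` over the uniform grid of `M` points on the circle. -/
noncomputable def gridMean (M : ℕ) (g : ℝ → ℝ) : ℝ :=
  (∑ l ∈ Finset.range M, g (gridPoint M l)) / M

lemma gridMean_mono {M : ℕ} {g h : ℝ → ℝ} (H : ∀ t, g t ≤ h t) : gridMean M g ≤ gridMean M h := by
  unfold gridMean
  gcongr
  exact H _

lemma gridMean_add (M : ℕ) (g h : ℝ → ℝ) :
    gridMean M (fun t => g t + h t) = gridMean M g + gridMean M h := by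
  simp [gridMean, Finset.sum_add_distrib, add_div]

lemma gridMean_const_mul (M : ℕ) (c : ℝ) (g : ℝ → ℝ) :
    gridMean M (fun t => c * g t) = c * gridMean M g := by
  simp [gridMean, ← Finset.mul_sum, mul_div_assoc]

lemma gridMean_const {M : ℕ} (hM : 0 < M) (c : ℝ) : gridMean M (fun _ => c) = c := by
  have : (M : ℝ) ≠ 0 := by positivity
  simp [gridMean, this]

lemma gridMean_nonneg {M : ℕ} {g : ℝ → ℝ} (H : ∀ t, 0 ≤ g t) : 0 ≤ gridMean M g :=
  div_nonneg (Finset.sum_nonneg fun _ _ => H _) (Nat.cast_nonneg _)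

lemma abs_gridMean_le (M : ℕ) (g : ℝ → ℝ) : |gridMean M g| ≤ gridMean M (fun t => |g t|) := by
  unfold gridMean
  rw [abs_div, Nat.abs_cast]
  gcongr
  exact Finset.abs_sum_le_sum_abs _ _

lemma sum_exp_gridPoint {M : ℕ} {j k : ℕ} (hj : j < M) (hk : k < M) :
    ∑ l ∈ Finset.range M, Complex.exp (Complex.I * j * gridPoint M l) *
      (starRingEnd ℂ) (Complex.exp (Complex.I * k * gridPoint M l)) =
      if j = k then (M : ℂ) else 0 := by
  have hM : M ≠ 0 := by omega
  have hMc : (M : ℂ) ≠ 0 := by exact_mod_cast hM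
  have hζ := Complex.isPrimitiveRoot_exp M hM
  set ζ := Complex.exp (2 * Real.pi * Complex.I / M) with hζd
  have hζ0 : ζ ≠ 0 := Complex.exp_ne_zero _
  have key : ∀ l ∈ Finset.range M, Complex.exp (Complex.I * j * gridPoint M l) *
      (starRingEnd ℂ) (Complex.exp (Complex.I * k * gridPoint M l)) =
      (ζ ^ j * (ζ ^ k)⁻¹) ^ l := by
    intro l _
    rw [mul_pow, inv_pow, ← pow_mul, ← pow_mul, hζd, ← Complex.exp_nat_mul, ← Complex.exp_nat_mul,
      ← Complex.exp_neg, ← Complex.exp_conj]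
    congr 2
    · simp only [gridPoint]; push_cast; field_simp
    · simp only [gridPoint]; simp [map_ofNat]; field_simp
  rw [Finset.sum_congr rfl key]
  split_ifs with h
  · subst h
    simp [hζ0]
  · have hw : ζ ^ j * (ζ ^ k)⁻¹ ≠ 1 := by
      intro hw
      apply h
      apply hζ.pow_inj hj hk
      field_simp at hw
      exact hw
    have hwM : (ζ ^ j * (ζ ^ k)⁻¹) ^ M = 1 := by
      rw [mul_pow, inv_pow, ← pow_mul, ← pow_mul, mul_comm j, mul_comm k, pow_mul, pow_mul,
        hζ.pow_eq_one]
      simp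
    have := mul_geom_sum (ζ ^ j * (ζ ^ k)⁻¹) M
    rw [hwM, sub_self] at this
    exact (mul_eq_zero.1 this).resolve_left (sub_ne_zero.2 hw)

/-- Parseval's identity on the uniform grid. -/
lemma gridMean_norm_sq {M : ℕ} (hM : 0 < M) {s : Finset ℕ} (hs : s ⊆ Finset.range M) (a : ℕ → ℂ) :
    gridMean M (fun t => ‖∑ k ∈ s, a k * Complex.exp (Complex.I * k * t)‖ ^ 2) =
      ∑ k ∈ s, ‖a k‖ ^ 2 := by
  have hM' : (M : ℝ) ≠ 0 := by positivity
  rw [gridMean, div_eq_iff hM', ← Complex.ofReal_inj]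
  push_cast
  simp_rw [← Complex.mul_conj', map_sum, Finset.sum_mul_sum, map_mul]
  rw [Finset.sum_comm, Finset.sum_mul]
  refine Finset.sum_congr rfl fun j hj => ?_
  rw [Finset.sum_comm]
  have : ∀ k ∈ s, ∑ l ∈ Finset.range M, a j * Complex.exp (Complex.I * j * gridPoint M l) *
      ((starRingEnd ℂ) (a k) * (starRingEnd ℂ) (Complex.exp (Complex.I * k * gridPoint M l))) =
      if j = k then a j * (starRingEnd ℂ) (a k) * M else 0 := by
    intro k hk
    have := sum_exp_gridPoint (Finset.mem_range.1 (hs hj)) (Finset.mem_range.1 (hs hk))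
    rw [← mul_ite_zero, ← this, Finset.mul_sum]
    exact Finset.sum_congr rfl fun l _ => by ring
  rw [Finset.sum_congr rfl this]
  simp [hj]

/-! ### The smoothing kernel -/

/-- The vector sin(kθ) with θ = π/(n+1) is the lowest eigenvector of the discrete Dirichlet
Laplacian. Its Rayleigh quotient 2 - 2 cos θ is at most θ². -/
lemma exists_sine_coeff (n : ℕ) (hn : 1 ≤ n) : ∃ a : ℕ → ℝ, a 0 = 0 ∧ a (n + 1) = 0 ∧
    ∑ k ∈ Finset.range n, a (k + 1) ^ 2 = 1 ∧
    ∑ k ∈ Finset.range (n + 1), (a k - a (k + 1)) ^ 2 ≤ (Real.pi / (n + 1)) ^ 2 := by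
  set θ : ℝ := Real.pi / (n + 1) with hθ
  set b : ℕ → ℝ := fun k => Real.sin (k * θ) with hb
  have b0 : b 0 = 0 := by simp [hb]
  have bn : b (n + 1) = 0 := by
    have : ((n + 1 : ℕ) : ℝ) * θ = Real.pi := by rw [hθ]; push_cast; field_simp
    simp only [hb]; rw [this, Real.sin_pi]
  set W := ∑ k ∈ Finset.range n, b (k + 1) ^ 2 with hW
  have hWpos : 0 < W := by
    have h1 : 0 < b 1 := by
      apply Real.sin_pos_of_pos_of_lt_pi
      · positivity
      · rw [hθ, Nat.cast_one, one_mul]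
        apply div_lt_self Real.pi_pos
        have : (1 : ℝ) ≤ n := by exact_mod_cast hn
        linarith
    calc 0 < b (0 + 1) ^ 2 := by simpa using pow_pos h1 2
      _ ≤ W := Finset.single_le_sum (f := fun k => b (k + 1) ^ 2) (fun _ _ => sq_nonneg _)
          (Finset.mem_range.2 hn)
  set T := ∑ k ∈ Finset.range (n + 1), b k * b (k + 1) with hT
  have hT1 : T = ∑ k ∈ Finset.range n, b k * b (k + 1) := by
    rw [hT, Finset.sum_range_succ, bn]; ring
  have hT2 : T = ∑ k ∈ Finset.range n, b (k + 1) * b (k + 2) := by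
    rw [hT, Finset.sum_range_succ', b0]; simp
  have hTW : 2 * T = 2 * Real.cos θ * W := by
    calc 2 * T = ∑ k ∈ Finset.range n, (b k * b (k + 1) + b (k + 1) * b (k + 2)) := by
          rw [Finset.sum_add_distrib, ← hT1, ← hT2]; ring
      _ = _ := by
          rw [hW, Finset.mul_sum]
          refine Finset.sum_congr rfl fun k _ => ?_
          have : b k + b (k + 2) = 2 * Real.cos θ * b (k + 1) := by
            simp only [hb]; push_cast
            have e1 : (k : ℝ) * θ = (k + 1) * θ - θ := by ring
            have e2 : ((k : ℝ) + 2) * θ = (k + 1) * θ + θ := by ring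
            rw [e1, e2, Real.sin_sub, Real.sin_add]; ring
          linear_combination b (k + 1) * this
  have hS : ∑ k ∈ Finset.range (n + 1), (b k - b (k + 1)) ^ 2 ≤ θ ^ 2 * W := by
    have e1 : ∑ k ∈ Finset.range (n + 1), b k ^ 2 = W := by
      rw [Finset.sum_range_succ', b0]; simp [hW]
    have e2 : ∑ k ∈ Finset.range (n + 1), b (k + 1) ^ 2 = W := by
      rw [Finset.sum_range_succ, bn]; simp [hW]
    have e3 : ∑ k ∈ Finset.range (n + 1), (b k - b (k + 1)) ^ 2 = W + W - 2 * T := by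
      rw [← e1.symm.trans e1, hT, Finset.mul_sum]
      conv_rhs => rw [← e1]
      nth_rw 2 [e1]
      rw [← e2, ← Finset.sum_add_distrib, ← Finset.sum_sub_distrib]
      exact Finset.sum_congr rfl fun k _ => by ring
    rw [e3, hTW]
    nlinarith [Real.one_sub_sq_div_two_le_cos (x := θ)]
  have hs : Real.sqrt W ^ 2 = W := Real.sq_sqrt hWpos.le
  refine ⟨fun k => b k / Real.sqrt W, by simp [b0], by simp [bn], ?_, ?_⟩
  · simp_rw [div_pow, hs, ← Finset.sum_div]
    exact div_self hWpos.ne'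
  · simp_rw [← sub_div, div_pow, hs, ← Finset.sum_div]
    rwa [div_le_iff₀ hWpos]

/-- The trigonometric polynomial `∑_{k < n} a_{k+1} e^{iky}`. -/
noncomputable def shiftedPoly (a : ℕ → ℝ) (n : ℕ) (y : ℝ) : ℂ :=
  ∑ k ∈ Finset.range n, (a (k + 1) : ℂ) * Complex.exp (Complex.I * k * y)

lemma gridMean_shiftedPoly {M n : ℕ} (hM : 0 < M) (hn : n ≤ M) (a : ℕ → ℝ) (x : ℝ) :
    gridMean M (fun t => ‖shiftedPoly a n (t - x)‖ ^ 2) = ∑ k ∈ Finset.range n, a (k + 1) ^ 2 := by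
  have := gridMean_norm_sq hM (Finset.range_subset_range.2 hn)
    (fun k => (a (k + 1) : ℂ) * Complex.exp ((-(k * x) : ℝ) * Complex.I))
  simp only [norm_mul, Complex.norm_exp_ofReal_mul_I, mul_one, Complex.norm_real, Real.norm_eq_abs,
    sq_abs] at this
  rw [← this]
  congr 1; funext t
  simp only [shiftedPoly]
  congr 2
  refine Finset.sum_congr rfl fun k _ => ?_
  rw [mul_assoc (a (k + 1) : ℂ), ← Complex.exp_add]
  congr 2
  push_cast; ring

/-- Summation by parts; the boundary zeros remove the end terms. Only indices k + 1 enter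
`shiftedPoly`, so the truncated `k - 1` is harmless. -/
lemma exp_sub_one_mul_shiftedPoly {n : ℕ} {a : ℕ → ℝ} (h0 : a 0 = 0) (hn : a (n + 1) = 0) (y : ℝ) :
    (Complex.exp (Complex.I * y) - 1) * shiftedPoly a n y =
      shiftedPoly (fun k => a (k - 1) - a k) (n + 1) y := by
  have e1 : Complex.exp (Complex.I * y) * shiftedPoly a n y =
      ∑ k ∈ Finset.range (n + 1), (a k : ℂ) * Complex.exp (Complex.I * k * y) := by
    rw [Finset.sum_range_succ', h0, shiftedPoly, Finset.mul_sum]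
    simp only [Complex.ofReal_zero, zero_mul, add_zero]
    refine Finset.sum_congr rfl fun k _ => ?_
    rw [mul_left_comm, ← Complex.exp_add]
    congr 2
    push_cast; ring
  have e2 : shiftedPoly a n y =
      ∑ k ∈ Finset.range (n + 1), (a (k + 1) : ℂ) * Complex.exp (Complex.I * k * y) := by
    rw [Finset.sum_range_succ, hn, shiftedPoly]; simp
  rw [sub_mul, one_mul, e1, e2, shiftedPoly, ← Finset.sum_sub_distrib]
  exact Finset.sum_congr rfl fun k _ => by push_cast [Nat.add_sub_cancel]; ring

/-- The chord |e^{ix} - e^{iy}| is the metric for all Lipschitz bounds, since it respects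
periodicity. -/
lemma norm_exp_sub_exp_nat_mul_le (k : ℕ) (x y : ℝ) :
    ‖Complex.exp (Complex.I * k * x) - Complex.exp (Complex.I * k * y)‖ ≤
      k * ‖Complex.exp (Complex.I * x) - Complex.exp (Complex.I * y)‖ := by
  have hx (x : ℝ) : Complex.exp (Complex.I * k * x) = Complex.exp (Complex.I * x) ^ k := by
    rw [← Complex.exp_nat_mul]; congr 1; ring
  have hn (x : ℝ) : ‖Complex.exp (Complex.I * x)‖ = 1 := by
    rw [mul_comm, Complex.norm_exp_ofReal_mul_I]
  rw [hx, hx]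
  have hz := hn x
  have hw := hn y
  generalize Complex.exp (Complex.I * x) = z at *
  generalize Complex.exp (Complex.I * y) = w at *
  clear hx hn
  induction k with
  | zero => simp
  | succ k ih =>
    calc ‖z ^ (k + 1) - w ^ (k + 1)‖ = ‖z ^ k * (z - w) + (z ^ k - w ^ k) * w‖ := by ring_nf
      _ ≤ ‖z ^ k * (z - w)‖ + ‖(z ^ k - w ^ k) * w‖ := norm_add_le _ _
      _ = ‖z - w‖ + ‖z ^ k - w ^ k‖ := by simp [hz, hw]
      _ ≤ (k + 1 : ℕ) * ‖z - w‖ := by push_cast; linarith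

/-- Grid mean of the increments of `‖p(t - ·)‖²`. -/
lemma gridMean_abs_kernel_sub_le {M n : ℕ} (hM : 0 < M) (hn : n ≤ M) {a : ℕ → ℝ}
    (ha : ∑ k ∈ Finset.range n, a (k + 1) ^ 2 = 1) (x y : ℝ) :
    gridMean M (fun t => |‖shiftedPoly a n (t - x)‖ ^ 2 - ‖shiftedPoly a n (t - y)‖ ^ 2|) ≤
      2 * n * ‖Complex.exp (Complex.I * x) - Complex.exp (Complex.I * y)‖ := by
  set D := n * ‖Complex.exp (Complex.I * x) - Complex.exp (Complex.I * y)‖ with hD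
  have hD0 : 0 ≤ D := by positivity
  have hdiff : gridMean M (fun t => ‖shiftedPoly a n (t - x) - shiftedPoly a n (t - y)‖ ^ 2) ≤
      D ^ 2 := by
    have := gridMean_norm_sq hM (Finset.range_subset_range.2 hn)
      (fun k => (a (k + 1) : ℂ) * (Complex.exp (Complex.I * k * (-x : ℝ)) -
        Complex.exp (Complex.I * k * (-y : ℝ))))
    have e : (fun t : ℝ => ‖shiftedPoly a n (t - x) - shiftedPoly a n (t - y)‖ ^ 2) =
      (fun t : ℝ => ‖∑ k ∈ Finset.range n, (a (k + 1) : ℂ) *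
        (Complex.exp (Complex.I * k * (-x : ℝ)) - Complex.exp (Complex.I * k * (-y : ℝ))) *
          Complex.exp (Complex.I * k * t)‖ ^ 2) := by
      funext t
      simp only [shiftedPoly, ← Finset.sum_sub_distrib]
      congr 2
      refine Finset.sum_congr rfl fun k _ => ?_
      rw [mul_assoc (a (k + 1) : ℂ), sub_mul, ← Complex.exp_add, ← Complex.exp_add, mul_sub]
      congr 3 <;> (push_cast; ring_nf)
    rw [e, this]
    calc _ ≤ ∑ k ∈ Finset.range n, a (k + 1) ^ 2 * D ^ 2 := by
          refine Finset.sum_le_sum fun k hk => ?_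
          rw [norm_mul, mul_pow, Complex.norm_real, Real.norm_eq_abs, sq_abs]
          gcongr
          refine (norm_exp_sub_exp_nat_mul_le k _ _).trans ?_
          rw [hD]
          have hc (x : ℝ) : Complex.exp (Complex.I * (-x : ℝ)) =
              (starRingEnd ℂ) (Complex.exp (Complex.I * x)) := by
            rw [← Complex.exp_conj]; simp
          rw [hc, hc, ← map_sub, RCLike.norm_conj]
          gcongr
          exact (Finset.mem_range.1 hk).le
      _ = D ^ 2 := by rw [← Finset.sum_mul, ha, one_mul]
  have hx := (gridMean_shiftedPoly hM hn a x).trans ha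
  have hy := (gridMean_shiftedPoly hM hn a y).trans ha
  refine le_of_forall_pos_le_add fun ε hε => ?_
  rw [mul_assoc, ← hD]
  -- E is the weight in the AM-GM form of Cauchy–Schwarz; the added ε/2 keeps it positive when D =
  -- 0.
  set E := D + ε / 2 with hE
  have hEpos : 0 < E := by positivity
  have key : ∀ t, |‖shiftedPoly a n (t - x)‖ ^ 2 - ‖shiftedPoly a n (t - y)‖ ^ 2| ≤
      E⁻¹ * ‖shiftedPoly a n (t - x) - shiftedPoly a n (t - y)‖ ^ 2 +
      (E / 2 * ‖shiftedPoly a n (t - x)‖ ^ 2 + E / 2 * ‖shiftedPoly a n (t - y)‖ ^ 2) := by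
    intro t
    have hw := abs_norm_sub_norm_le (shiftedPoly a n (t - x)) (shiftedPoly a n (t - y))
    have hu := norm_nonneg (shiftedPoly a n (t - x))
    have hv := norm_nonneg (shiftedPoly a n (t - y))
    generalize ‖shiftedPoly a n (t - x) - shiftedPoly a n (t - y)‖ = w at *
    generalize ‖shiftedPoly a n (t - x)‖ = u at *
    generalize ‖shiftedPoly a n (t - y)‖ = v at *
    have amgm (u : ℝ) : w * u ≤ E⁻¹ * w ^ 2 / 2 + E / 2 * u ^ 2 := by
      have : E⁻¹ * w ^ 2 / 2 + E / 2 * u ^ 2 - w * u = E⁻¹ / 2 * (w - E * u) ^ 2 := by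
        field_simp; ring
      nlinarith [show 0 ≤ E⁻¹ / 2 * (w - E * u) ^ 2 by positivity]
    calc |u ^ 2 - v ^ 2| = |u - v| * (u + v) := by
          rw [sq_sub_sq, abs_mul, abs_of_nonneg (add_nonneg hu hv), mul_comm]
      _ ≤ w * (u + v) := by gcongr
      _ ≤ _ := by linarith [amgm u, amgm v]
  refine (gridMean_mono key).trans ?_
  simp only [gridMean_add, gridMean_const_mul, hx, hy]
  have h1 : E⁻¹ * gridMean M
      (fun t => ‖shiftedPoly a n (t - x) - shiftedPoly a n (t - y)‖ ^ 2) ≤ E⁻¹ * E ^ 2 := by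
    gcongr
    refine hdiff.trans ?_
    gcongr
    linarith
  have e : E⁻¹ * E ^ 2 = E := by field_simp
  linarith

/-- The kernel concentrates at scale θ: Cauchy–Schwarz, as AM-GM with weight θ, pairs p with (e^{iy}
- 1)p, whose coefficients are the differences of a. That product has n + 1 terms, hence `n < M`. -/
lemma gridMean_norm_exp_sub_one_mul_le {M n : ℕ} (hnM : n < M) {a : ℕ → ℝ}
    (h0 : a 0 = 0) (hn : a (n + 1) = 0) (ha : ∑ k ∈ Finset.range n, a (k + 1) ^ 2 = 1)
    {θ : ℝ} (hθ : 0 < θ) (hv : ∑ k ∈ Finset.range (n + 1), (a k - a (k + 1)) ^ 2 ≤ θ ^ 2) (x : ℝ) :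
    gridMean M (fun t => ‖Complex.exp (Complex.I * t) - Complex.exp (Complex.I * x)‖ *
      ‖shiftedPoly a n (t - x)‖ ^ 2) ≤ θ := by
  have hM : 0 < M := by omega
  have h1 := (gridMean_shiftedPoly hM hnM.le a x).trans ha
  have h2 := gridMean_shiftedPoly hM hnM (fun k => a (k - 1) - a k) x
  simp only [Nat.add_sub_cancel, ← exp_sub_one_mul_shiftedPoly h0 hn] at h2
  have key : ∀ t : ℝ, ‖Complex.exp (Complex.I * t) - Complex.exp (Complex.I * x)‖ *
      ‖shiftedPoly a n (t - x)‖ ^ 2 ≤ θ / 2 * ‖shiftedPoly a n (t - x)‖ ^ 2 + θ⁻¹ / 2 *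
      ‖(Complex.exp (Complex.I * (t - x : ℝ)) - 1) * shiftedPoly a n (t - x)‖ ^ 2 := by
    intro t
    have e : ‖Complex.exp (Complex.I * t) - Complex.exp (Complex.I * x)‖ =
        ‖Complex.exp (Complex.I * (t - x : ℝ)) - 1‖ := by
      have : Complex.exp (Complex.I * t) - Complex.exp (Complex.I * x) =
          Complex.exp (x * Complex.I) * (Complex.exp (Complex.I * (t - x : ℝ)) - 1) := by
        rw [mul_sub, ← Complex.exp_add, mul_one]; congr 2 <;> (push_cast; ring)
      rw [this, norm_mul, Complex.norm_exp_ofReal_mul_I, one_mul]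
    rw [e, norm_mul, mul_pow]
    generalize ‖Complex.exp (Complex.I * (t - x : ℝ)) - 1‖ = w
    have : w ≤ θ / 2 + θ⁻¹ / 2 * w ^ 2 := by
      have : θ / 2 + θ⁻¹ / 2 * w ^ 2 - w = θ⁻¹ / 2 * (w - θ) ^ 2 := by
        field_simp; ring
      nlinarith [show 0 ≤ θ⁻¹ / 2 * (w - θ) ^ 2 by positivity]
    nlinarith [mul_le_mul_of_nonneg_right this (sq_nonneg ‖shiftedPoly a n (t - x)‖)]
  refine (gridMean_mono key).trans ?_
  simp only [gridMean_add, gridMean_const_mul, h1, h2]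
  have : θ⁻¹ / 2 * ∑ k ∈ Finset.range (n + 1), (a k - a (k + 1)) ^ 2 ≤ θ⁻¹ / 2 * θ ^ 2 := by
    gcongr
  have e : θ⁻¹ / 2 * θ ^ 2 = θ / 2 := by field_simp
  linarith

/-! ### Discrete convolution -/

/-- Discrete convolution of `f` with the kernel `‖shiftedPoly a n ·‖²`. -/
noncomputable def gridConv (M n : ℕ) (a : ℕ → ℝ) (f : ℝ → ℝ) (x : ℝ) : ℝ :=
  gridMean M (fun t => f t * ‖shiftedPoly a n (t - x)‖ ^ 2)

lemma gridConv_nonneg {M n : ℕ} {a : ℕ → ℝ} {f : ℝ → ℝ} (hf : ∀ t, 0 ≤ f t) (x : ℝ) :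
    0 ≤ gridConv M n a f x :=
  gridMean_nonneg fun t => mul_nonneg (hf t) (sq_nonneg _)

lemma gridConv_le_one {M n : ℕ} (hM : 0 < M) (hn : n ≤ M) {a : ℕ → ℝ}
    (ha : ∑ k ∈ Finset.range n, a (k + 1) ^ 2 = 1) {f : ℝ → ℝ} (hf : ∀ t, f t ≤ 1) (x : ℝ) :
    gridConv M n a f x ≤ 1 := by
  rw [← (gridMean_shiftedPoly hM hn a x).trans ha]
  exact gridMean_mono fun t => mul_le_of_le_one_left (sq_nonneg _) (hf t)

lemma abs_gridConv_sub_le {M n : ℕ} (hM : 0 < M) (hn : n ≤ M) {a : ℕ → ℝ}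
    (ha : ∑ k ∈ Finset.range n, a (k + 1) ^ 2 = 1) {f : ℝ → ℝ} (hf0 : ∀ t, 0 ≤ f t)
    (hf : ∀ t, f t ≤ 1) (x y : ℝ) :
    |gridConv M n a f x - gridConv M n a f y| ≤
      2 * n * ‖Complex.exp (Complex.I * x) - Complex.exp (Complex.I * y)‖ := by
  have e : gridConv M n a f x - gridConv M n a f y = gridMean M (fun t =>
      f t * (‖shiftedPoly a n (t - x)‖ ^ 2 - ‖shiftedPoly a n (t - y)‖ ^ 2)) := by
    simp only [gridConv, gridMean, ← sub_div, ← Finset.sum_sub_distrib, mul_sub]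
  rw [e]
  refine (abs_gridMean_le _ _).trans
    (le_trans (gridMean_mono fun t => ?_) (gridMean_abs_kernel_sub_le hM hn ha x y))
  rw [abs_mul, abs_of_nonneg (hf0 t)]
  exact mul_le_of_le_one_left (abs_nonneg _) (hf t)

lemma gridConv_le_add {M n : ℕ} (hnM : n < M) {a : ℕ → ℝ}
    (h0 : a 0 = 0) (hn : a (n + 1) = 0) (ha : ∑ k ∈ Finset.range n, a (k + 1) ^ 2 = 1)
    {θ : ℝ} (hθ : 0 < θ) (hv : ∑ k ∈ Finset.range (n + 1), (a k - a (k + 1)) ^ 2 ≤ θ ^ 2)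
    {f : ℝ → ℝ} {L : ℝ} (hL : 0 ≤ L)
    (hf : ∀ x y, |f x - f y| ≤ L * ‖Complex.exp (Complex.I * x) - Complex.exp (Complex.I * y)‖)
    (x : ℝ) : gridConv M n a f x ≤ f x + L * θ := by
  have hM : 0 < M := by omega
  have key : ∀ t : ℝ, f t * ‖shiftedPoly a n (t - x)‖ ^ 2 ≤ f x * ‖shiftedPoly a n (t - x)‖ ^ 2 +
      L * (‖Complex.exp (Complex.I * t) - Complex.exp (Complex.I * x)‖ *
        ‖shiftedPoly a n (t - x)‖ ^ 2) := by
    intro t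
    rw [← mul_assoc, ← add_mul]
    gcongr
    linarith [le_abs_self (f t - f x), hf t x]
  refine (gridMean_mono key).trans ?_
  rw [gridMean_add, gridMean_const_mul, gridMean_const_mul,
    (gridMean_shiftedPoly hM hnM.le a x).trans ha, mul_one]
  gcongr
  exact gridMean_norm_exp_sub_one_mul_le hnM h0 hn ha hθ hv x

lemma norm_shiftedPoly_sq (a : ℕ → ℝ) (n : ℕ) (y : ℝ) :
    ((‖shiftedPoly a n y‖ ^ 2 : ℝ) : ℂ) = ∑ k ∈ Finset.range n, ∑ l ∈ Finset.range n,
      (a (k + 1) : ℂ) * a (l + 1) * Complex.exp (Complex.I * (k - l) * y) := by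
  push_cast
  rw [← Complex.mul_conj', shiftedPoly, map_sum, Finset.sum_mul_sum]
  refine Finset.sum_congr rfl fun k _ => Finset.sum_congr rfl fun l _ => ?_
  rw [map_mul, ← Complex.exp_conj, mul_mul_mul_comm, ← Complex.exp_add, Complex.conj_ofReal]
  congr 2
  simp
  ring

/-- Averaging over x and -x turns the phases in t into cosines, which makes the Fourier coefficients
of the smoothed function real. Swapping k and l in the first kernel aligns the exponentials in x. -/
lemma norm_shiftedPoly_sq_add (a : ℕ → ℝ) (n : ℕ) (t x : ℝ) :
    (((‖shiftedPoly a n (t - x)‖ ^ 2 + ‖shiftedPoly a n (t - -x)‖ ^ 2) / 2 : ℝ) : ℂ) =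
      ∑ k ∈ Finset.range n, ∑ l ∈ Finset.range n, (a (k + 1) : ℂ) * a (l + 1) *
        Complex.cos ((k - l) * t) * Complex.exp (Complex.I * (k - l) * x) := by
  rw [Complex.ofReal_div, Complex.ofReal_add, norm_shiftedPoly_sq, norm_shiftedPoly_sq,
    Finset.sum_comm, ← Finset.sum_add_distrib, Finset.sum_div]
  refine Finset.sum_congr rfl fun k _ => ?_
  rw [← Finset.sum_add_distrib, Finset.sum_div]
  refine Finset.sum_congr rfl fun l _ => ?_
  have e1 : Complex.exp (Complex.I * (l - k) * (t - x : ℝ)) =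
      Complex.exp (-((k - l) * t) * Complex.I) * Complex.exp (Complex.I * (k - l) * x) := by
    rw [← Complex.exp_add]; congr 1; push_cast; ring
  have e2 : Complex.exp (Complex.I * (k - l) * (t - -x : ℝ)) =
      Complex.exp (((k - l) * t) * Complex.I) * Complex.exp (Complex.I * (k - l) * x) := by
    rw [← Complex.exp_add]; congr 1; push_cast; ring
  rw [e1, e2, Complex.cos]
  push_cast
  ring

lemma gridConv_add_neg (M n : ℕ) (a : ℕ → ℝ) (f : ℝ → ℝ) (x : ℝ) :
    (((gridConv M n a f x + gridConv M n a f (-x)) / 2 : ℝ) : ℂ) =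
      ∑ k ∈ Finset.range n, ∑ l ∈ Finset.range n, ((a (k + 1) * a (l + 1) *
        gridMean M (fun t => f t * Real.cos ((k - l) * t)) : ℝ) : ℂ) *
          Complex.exp (Complex.I * (k - l) * x) := by
  have e : (gridConv M n a f x + gridConv M n a f (-x)) / 2 = gridMean M (fun t => f t *
      ((‖shiftedPoly a n (t - x)‖ ^ 2 + ‖shiftedPoly a n (t - -x)‖ ^ 2) / 2)) := by
    rw [gridConv, gridConv, ← gridMean_add, div_eq_inv_mul, ← gridMean_const_mul]
    congr 1; funext t; ring
  rw [e, gridMean]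
  simp only [gridMean]
  rw [Complex.ofReal_div, Complex.ofReal_sum]
  simp only [Complex.ofReal_mul (f _), norm_shiftedPoly_sq_add]
  simp only [Finset.mul_sum, Finset.sum_div]
  rw [Finset.sum_comm]
  refine Finset.sum_congr rfl fun k _ => ?_
  rw [Finset.sum_comm]
  refine Finset.sum_congr rfl fun l _ => ?_
  push_cast
  rw [Finset.sum_mul]
  refine Finset.sum_congr rfl fun j _ => ?_
  ring

/-! ### Trigonometric polynomials with real coefficients in a window -/

lemma IsTrigPolyOn.zero (m d : ℕ) : IsTrigPolyOn m d (fun _ => 0) :=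
  ⟨fun _ => 0, by simp⟩

lemma IsTrigPolyOn.add {m d : ℕ} {f g : ℝ → ℂ} (hf : IsTrigPolyOn m d f)
    (hg : IsTrigPolyOn m d g) : IsTrigPolyOn m d (fun x => f x + g x) := by
  obtain ⟨b, hb⟩ := hf
  obtain ⟨c, hc⟩ := hg
  refine ⟨fun s => b s + c s, fun x => ?_⟩
  simp only [hb, hc, ← Finset.sum_add_distrib]
  exact Finset.sum_congr rfl fun s _ => by push_cast; ring

lemma IsTrigPolyOn.sum {ι : Type*} {m d : ℕ} {s : Finset ι} {f : ι → ℝ → ℂ}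
    (h : ∀ i ∈ s, IsTrigPolyOn m d (f i)) : IsTrigPolyOn m d (fun x => ∑ i ∈ s, f i x) := by
  classical
  induction s using Finset.induction_on with
  | empty => simpa using IsTrigPolyOn.zero m d
  | insert i s hi ih =>
    simp only [Finset.sum_insert hi]
    exact (h i (Finset.mem_insert_self _ _)).add
      (ih fun j hj => h j (Finset.mem_insert_of_mem hj))

lemma IsTrigPolyOn.monomial {m d s : ℕ} (h1 : m ≤ s) (h2 : s < m + d) (c : ℝ) :
    IsTrigPolyOn m d (fun x => (c : ℂ) * Complex.exp (Complex.I * s * x)) := by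
  refine ⟨fun t => if t = s then c else 0, fun x => ?_⟩
  rw [Finset.sum_eq_single s]
  · simp
  · intro t _ ht; simp [ht]
  · intro h; exact absurd (Finset.mem_Ico.2 ⟨h1, h2⟩) h

lemma IsTrigPolyOn.mono {m d m' d' : ℕ} {f : ℝ → ℂ} (hf : IsTrigPolyOn m d f) (h1 : m' ≤ m)
    (h2 : m + d ≤ m' + d') : IsTrigPolyOn m' d' f := by
  obtain ⟨c, hc⟩ := hf
  have : f = fun x : ℝ => ∑ s ∈ Finset.Ico m (m + d), (c s : ℂ) *
    Complex.exp (Complex.I * (s : ℂ) * (x : ℂ)) := funext hc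
  rw [this]
  refine IsTrigPolyOn.sum fun s hs => ?_
  rw [Finset.mem_Ico] at hs
  exact IsTrigPolyOn.monomial (by omega) (by omega) _

lemma IsTrigPolyOn.continuous {m d : ℕ} {f : ℝ → ℂ} (hf : IsTrigPolyOn m d f) : Continuous f := by
  obtain ⟨c, hc⟩ := hf
  rw [funext hc]
  fun_prop

/-- Makes the modulus of a partial sum even, so that symmetrizing in x leaves the cutoff unchanged.
-/
lemma IsTrigPolyOn.conj {m d : ℕ} {f : ℝ → ℂ} (hf : IsTrigPolyOn m d f) (x : ℝ) :
    f (-x) = (starRingEnd ℂ) (f x) := by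
  obtain ⟨c, hc⟩ := hf
  rw [hc, hc, map_sum]
  refine Finset.sum_congr rfl fun s _ => ?_
  rw [map_mul, ← Complex.exp_conj]
  simp

lemma gridMean_norm_sq_add {M m : ℕ} (hM : 0 < M) (hm : m ≤ M) {f g : ℝ → ℂ}
    (hf : IsTrigPolyOn 0 m f) (hg : IsTrigPolyOn m (M - m) g) :
    gridMean M (fun t => ‖f t + g t‖ ^ 2) =
      gridMean M (fun t => ‖f t‖ ^ 2) + gridMean M (fun t => ‖g t‖ ^ 2) := by
  obtain ⟨b, hb⟩ := hf
  obtain ⟨c, hc⟩ := hg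
  rw [zero_add, Nat.Ico_zero_eq_range] at hb
  rw [Nat.add_sub_cancel' hm] at hc
  have hfg (t : ℝ) : f t + g t = ∑ s ∈ Finset.range M,
      (if s < m then (b s : ℂ) else c s) * Complex.exp (Complex.I * s * t) := by
    rw [hb, hc, ← Finset.sum_range_add_sum_Ico _ hm]
    congr 1
    · exact Finset.sum_congr rfl fun s hs => by rw [if_pos (Finset.mem_range.1 hs)]
    · exact Finset.sum_congr rfl fun s hs => by
        rw [if_neg (not_lt.2 (Finset.mem_Ico.1 hs).1)]
  simp only [hfg]
  simp only [hb, hc]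
  rw [gridMean_norm_sq hM subset_rfl, gridMean_norm_sq hM (Finset.range_subset_range.2 hm),
    gridMean_norm_sq hM (fun s hs => Finset.mem_range.2 (Finset.mem_Ico.1 hs).2),
    ← Finset.sum_range_add_sum_Ico _ hm]
  congr 1
  · exact Finset.sum_congr rfl fun s hs => by rw [if_pos (Finset.mem_range.1 hs)]
  · exact Finset.sum_congr rfl fun s hs => by
      rw [if_neg (not_lt.2 (Finset.mem_Ico.1 hs).1)]

/-! ### Normalized measure on the circle -/

instance isProbabilityMeasure_circleMeasure : IsProbabilityMeasure circleMeasure := by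
  constructor
  have : ENNReal.ofReal (2 * Real.pi) ≠ 0 := by simp [Real.pi_pos]
  rw [circleMeasure, Measure.smul_apply, Measure.restrict_apply_univ, Real.volume_Ioo, sub_zero,
    smul_eq_mul, ENNReal.inv_mul_cancel this ENNReal.ofReal_ne_top]

lemma integral_circleMeasure (h : ℝ → ℂ) :
    ∫ x, h x ∂circleMeasure = (2 * Real.pi : ℂ)⁻¹ * ∫ x in (0 : ℝ)..(2 * Real.pi), h x := by
  have h0 : (0 : ℝ) ≤ 2 * Real.pi := by positivity
  rw [circleMeasure, integral_smul_measure, intervalIntegral.integral_of_le h0,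
    integral_Ioc_eq_integral_Ioo, ENNReal.toReal_inv, ENNReal.toReal_ofReal h0, Complex.real_smul]
  push_cast
  rfl

lemma integral_exp_circleMeasure (k : ℤ) :
    ∫ x : ℝ, Complex.exp (Complex.I * k * x) ∂circleMeasure = if k = 0 then 1 else 0 := by
  rw [integral_circleMeasure]
  split_ifs with hk
  · subst hk
    have : (Real.pi : ℂ) ≠ 0 := by exact_mod_cast Real.pi_ne_zero
    simp
    field_simp
  · have hc : Complex.I * k ≠ 0 := mul_ne_zero Complex.I_ne_zero (by exact_mod_cast hk)
    rw [integral_exp_mul_complex hc]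
    have : Complex.exp (Complex.I * k * (2 * Real.pi : ℝ)) = 1 := by
      rw [← Complex.exp_int_mul_two_pi_mul_I k]; congr 1; push_cast; ring
    rw [this]
    simp

lemma integrable_circleMeasure {h : ℝ → ℂ} (hc : Continuous h) : Integrable h circleMeasure := by
  have : ENNReal.ofReal (2 * Real.pi) ≠ 0 := by simp [Real.pi_pos]
  refine Integrable.smul_measure ?_ (ENNReal.inv_ne_top.2 this)
  exact (hc.integrableOn_Icc (μ := volume) (a := 0) (b := 2 * Real.pi)).mono_set
    Set.Ioo_subset_Icc_self

lemma eLpNorm_top_circleMeasure_le {h : ℝ → ℂ} {C : ℝ} (H : ∀ x, ‖h x‖ ≤ C) :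
    eLpNorm h ⊤ circleMeasure ≤ ENNReal.ofReal C := by
  rw [eLpNorm_exponent_top]
  exact eLpNormEssSup_le_of_ae_bound (Filter.Eventually.of_forall H)

/-! ### The building block -/

/-- The building block: an amplitude `f` with values in `[0, 1]` is modulated into the frequency
window `[m, m + d)`. -/
lemma exists_block {m d : ℕ} (hm : 0 < m) (hd : 1 ≤ d) {f : ℝ → ℝ} (hf0 : ∀ x, 0 ≤ f x)
    (hf1 : ∀ x, f x ≤ 1) : ∃ g : ℝ → ℂ, IsTrigPolyOn m d g ∧ (∀ x, ‖g x‖ ≤ 1) ∧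
      (∀ x y : ℝ, ‖g x - g y‖ ≤
        (m + 2 * d) * ‖Complex.exp (Complex.I * x) - Complex.exp (Complex.I * y)‖) ∧
      ENNReal.ofReal (gridMean (m + d) f) ≤ eLpNorm g 1 circleMeasure ∧
      ∀ L : ℝ, 0 ≤ L → (∀ x, f (-x) = f x) →
        (∀ x y : ℝ, |f x - f y| ≤
          L * ‖Complex.exp (Complex.I * x) - Complex.exp (Complex.I * y)‖) →
        ∀ x, ‖g x‖ ≤ f x + 7 * L / d := by
  set M := m + d with hMdef
  -- The frequencies k - l fill [-(n-1), n-1], and 2n - 1 ≤ d lets them fit in the window after a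
  -- shift by m + n - 1.
  set n := (d + 1) / 2 with hndef
  have hn1 : 1 ≤ n := by omega
  have hM : 0 < M := by omega
  have hnM : n < M := by omega
  obtain ⟨a, h0, hn, ha, hv⟩ := exists_sine_coeff n hn1
  set σ : ℝ → ℝ := fun x => (gridConv M n a f x + gridConv M n a f (-x)) / 2 with hσ
  have hσ0 (x : ℝ) : 0 ≤ σ x := by
    have := gridConv_nonneg (M := M) (n := n) (a := a) hf0
    exact div_nonneg (add_nonneg (this x) (this (-x))) zero_le_two
  have hσ1 (x : ℝ) : σ x ≤ 1 := by
    have := gridConv_le_one hM hnM.le ha hf1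
    simp only [hσ]
    linarith [this x, this (-x)]
  have hexp (k : ℕ) (x : ℝ) : ‖Complex.exp (Complex.I * k * x)‖ = 1 := by
    rw [Complex.norm_exp]; simp
  set g : ℝ → ℂ := fun x => Complex.exp (Complex.I * (m + n - 1 : ℕ) * x) * (σ x : ℂ) with hg
  have hgn (x : ℝ) : ‖g x‖ = σ x := by
    rw [hg]
    simp only [norm_mul, hexp, one_mul, Complex.norm_real, Real.norm_eq_abs, abs_of_nonneg (hσ0 x)]
  have hgsum (x : ℝ) : g x = ∑ k ∈ Finset.range n, ∑ l ∈ Finset.range n,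
      ((a (k + 1) * a (l + 1) * gridMean M (fun t => f t * Real.cos ((k - l) * t)) : ℝ) : ℂ) *
          Complex.exp (Complex.I * (m + k + (n - 1 - l) : ℕ) * x) := by
    simp only [hg, hσ]
    rw [gridConv_add_neg, Finset.mul_sum]
    refine Finset.sum_congr rfl fun k _ => ?_
    rw [Finset.mul_sum]
    refine Finset.sum_congr rfl fun l hl => ?_
    rw [mul_left_comm, ← Complex.exp_add]
    congr 2
    have h1 : m + k + (n - 1 - l) + l = (m + n - 1) + k := by
      have := Finset.mem_range.1 hl
      omega
    have h2 : ((m + k + (n - 1 - l) : ℕ) : ℂ) + l = (m + n - 1 : ℕ) + k := by exact_mod_cast h1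
    linear_combination (-Complex.I * x) * h2
  have hgpoly : IsTrigPolyOn m d g := by
    rw [funext hgsum]
    refine IsTrigPolyOn.sum fun k hk => IsTrigPolyOn.sum fun l hl => ?_
    rw [Finset.mem_range] at hk hl
    exact IsTrigPolyOn.monomial (by omega) (by omega) _
  refine ⟨g, hgpoly, fun x => (hgn x).trans_le (hσ1 x), ?_, ?_, ?_⟩
  · intro x y
    set D := ‖Complex.exp (Complex.I * x) - Complex.exp (Complex.I * y)‖ with hD
    have hDneg : ‖Complex.exp (Complex.I * (-x : ℝ)) - Complex.exp (Complex.I * (-y : ℝ))‖ = D := by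
      have hc (x : ℝ) : Complex.exp (Complex.I * (-x : ℝ)) =
          (starRingEnd ℂ) (Complex.exp (Complex.I * x)) := by
        rw [← Complex.exp_conj]; simp
      rw [hc, hc, ← map_sub, RCLike.norm_conj]
    have hσd : |σ x - σ y| ≤ 2 * n * D := by
      have h1 := abs_gridConv_sub_le hM hnM.le ha hf0 hf1 x y
      have h2 := abs_gridConv_sub_le hM hnM.le ha hf0 hf1 (-x) (-y)
      rw [hDneg] at h2
      rw [abs_le] at h1 h2 ⊢
      simp only [hσ]
      constructor <;> linarith
    have e : g x - g y = (Complex.exp (Complex.I * (m + n - 1 : ℕ) * x) -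
        Complex.exp (Complex.I * (m + n - 1 : ℕ) * y)) * (σ x : ℂ) +
        Complex.exp (Complex.I * (m + n - 1 : ℕ) * y) * ((σ x - σ y : ℝ) : ℂ) := by
      simp only [hg]; push_cast; ring
    have h3 := norm_exp_sub_exp_nat_mul_le (m + n - 1) x y
    have h4 : ((m + n - 1 : ℕ) : ℝ) + 2 * n ≤ m + 2 * d := by
      have : m + n - 1 + 2 * n ≤ m + 2 * d := by omega
      exact_mod_cast this
    calc ‖g x - g y‖ ≤ (m + n - 1 : ℕ) * D * 1 + 1 * (2 * n * D) := by
          rw [e]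
          refine (norm_add_le _ _).trans (add_le_add ?_ ?_)
          · rw [norm_mul, Complex.norm_real, Real.norm_eq_abs, abs_of_nonneg (hσ0 x)]
            exact mul_le_mul h3 (hσ1 x) (hσ0 x) (by positivity)
          · rw [norm_mul, hexp, Complex.norm_real, Real.norm_eq_abs]
            gcongr
      _ = ((m + n - 1 : ℕ) + 2 * n) * D := by ring
      _ ≤ (m + 2 * d) * D := by gcongr
  -- The Fourier coefficient at m + n - 1 sees only the diagonal k = l; it is at most the L¹ norm.
  · have hint : ∫ x, g x * Complex.exp (Complex.I * (-(m + n - 1 : ℕ) : ℤ) * x) ∂circleMeasure =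
        (gridMean M f : ℂ) := by
      have e (x : ℝ) : g x * Complex.exp (Complex.I * (-(m + n - 1 : ℕ) : ℤ) * x) =
          ∑ k ∈ Finset.range n, ∑ l ∈ Finset.range n,
            ((a (k + 1) * a (l + 1) * gridMean M (fun t => f t * Real.cos ((k - l) * t)) : ℝ) : ℂ) *
              Complex.exp (Complex.I * ((k : ℤ) - l : ℤ) * x) := by
        simp only [hg, hσ]
        rw [gridConv_add_neg, mul_right_comm, ← Complex.exp_add]
        have : Complex.I * (m + n - 1 : ℕ) * (x : ℂ) +
          Complex.I * (-(m + n - 1 : ℕ) : ℤ) * x = 0 := by push_cast; ring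
        rw [this, Complex.exp_zero, one_mul]
        refine Finset.sum_congr rfl fun k _ => Finset.sum_congr rfl fun l hl => ?_
        push_cast; rfl
      simp only [e]
      rw [integral_finsetSum _ fun k _ => integrable_circleMeasure (by fun_prop)]
      have : ∀ k ∈ Finset.range n, ∫ x : ℝ, ∑ l ∈ Finset.range n,
            ((a (k + 1) * a (l + 1) * gridMean M (fun t => f t * Real.cos ((k - l) * t)) : ℝ) : ℂ) *
              Complex.exp (Complex.I * ((k : ℤ) - l : ℤ) * x) ∂circleMeasure =
          ((a (k + 1) ^ 2 * gridMean M f : ℝ) : ℂ) := by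
        intro k hk
        rw [integral_finsetSum _ fun l _ => integrable_circleMeasure (by fun_prop),
          Finset.sum_eq_single_of_mem k hk]
        · rw [integral_const_mul, integral_exp_circleMeasure]
          simp [sq]
        · intro l _ hlk
          rw [integral_const_mul, integral_exp_circleMeasure, if_neg (by omega), mul_zero]
      rw [Finset.sum_congr rfl this, ← Complex.ofReal_sum, ← Finset.sum_mul, ha, one_mul]
    have hmean0 : 0 ≤ gridMean M f := gridMean_nonneg hf0
    rw [eLpNorm_one_eq_lintegral_enorm]
    calc ENNReal.ofReal (gridMean M f) = ‖(gridMean M f : ℂ)‖ₑ := by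
          rw [← ofReal_norm, Complex.norm_real, Real.norm_eq_abs, abs_of_nonneg hmean0]
      _ ≤ ∫⁻ x, ‖g x * Complex.exp (Complex.I * (-(m + n - 1 : ℕ) : ℤ) * x)‖ₑ ∂circleMeasure := by
          rw [← hint]; exact enorm_integral_le_lintegral_enorm _
      _ = ∫⁻ x, ‖g x‖ₑ ∂circleMeasure := by
          congr 1; funext x
          rw [← ofReal_norm, ← ofReal_norm, norm_mul]
          have : ‖Complex.exp (Complex.I * (-(m + n - 1 : ℕ) : ℤ) * x)‖ = 1 := by
            rw [Complex.norm_exp]; simp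
          rw [this, mul_one]
  · intro L hL heven hLip x
    have hθ : (0 : ℝ) < Real.pi / (n + 1) := by positivity
    have h1 := gridConv_le_add hnM h0 hn ha hθ hv hL hLip x
    have h2 := gridConv_le_add hnM h0 hn ha hθ hv hL hLip (-x)
    rw [heven] at h2
    -- From d ≤ 2n and 2π < 7.
    have h3 : Real.pi / (n + 1) ≤ 7 / d := by
      rw [div_le_div_iff₀ (by positivity) (by positivity)]
      have : (d : ℝ) ≤ 2 * n := by
        have : d ≤ 2 * n := by omega
        exact_mod_cast this
      nlinarith [Real.pi_lt_d2, Real.pi_pos]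
    have h4 : L * (Real.pi / (n + 1)) ≤ L * (7 / d) := by gcongr
    rw [hgn]
    simp only [hσ]
    have e : 7 * L / d = L * (7 / d) := by ring
    linarith

/-! ### Delayed recursion and growth of the partial sums -/

/-- The sequence in which the `j`-th term is obtained by applying `G j` to the partial sum up to
`j - r j`. -/
noncomputable def delayedSeq (G : ℕ → (ℝ → ℂ) → ℝ → ℂ) (r : ℕ → ℕ) (j : ℕ) : ℝ → ℂ :=
  G j (fun x => ∑ i : Fin j, if 1 ≤ i.1 ∧ i.1 ≤ j - r j then delayedSeq G r i.1 x else 0)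
termination_by j
decreasing_by exact i.2

lemma delayedSeq_eq (G : ℕ → (ℝ → ℂ) → ℝ → ℂ) {r : ℕ → ℕ} (hr : ∀ j, 1 ≤ r j) (j : ℕ) :
    delayedSeq G r j = G j (fun x => ∑ i ∈ Finset.Icc 1 (j - r j), delayedSeq G r i x) := by
  rw [delayedSeq]
  congr 1
  funext x
  rw [Fin.sum_univ_eq_sum_range
    (fun i => if 1 ≤ i ∧ i ≤ j - r j then delayedSeq G r i x else 0) j, ← Finset.sum_filter]
  congr 1
  ext i
  have := hr j
  simp only [Finset.mem_filter, Finset.mem_range, Finset.mem_Icc]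
  omega

/-- Telescoping: 1/(N+1)² ≤ 1/N - 1/(N+1). -/
lemma sum_inv_sq_le (c : ℝ) (hc : 0 ≤ c) (N : ℕ) :
    ∑ i ∈ Finset.Icc 1 N, c / (i : ℝ) ^ 2 ≤ 2 * c := by
  suffices h : ∀ N : ℕ, ∑ i ∈ Finset.Icc 1 (N + 1), c / (i : ℝ) ^ 2 ≤ 2 * c - c / (N + 1 : ℝ) by
    rcases N with _ | N
    · simpa using hc
    · exact (h N).trans (sub_le_self _ (by positivity))
  intro N
  induction N with
  | zero => simp; linarith
  | succ N ih =>
    rw [Finset.sum_Icc_succ_top (by omega)]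
    have : c / ((N + 1 + 1 : ℕ) : ℝ) ^ 2 ≤ c / (N + 1 : ℝ) - c / (N + 1 + 1 : ℝ) := by
      rw [div_sub_div _ _ (by positivity) (by positivity), div_le_div_iff₀ (by positivity)
        (by positivity)]
      push_cast
      nlinarith [mul_nonneg hc (by positivity : (0 : ℝ) ≤ N + 1 + 1)]
    push_cast at this ⊢
    linarith

/-- If each increment is negligible whenever the partial sum `r j` steps earlier is large, then the
partial sums stay of order `√N` plus the delay. -/
lemma norm_sum_le_of_delayed {v : ℕ → ℂ} {ε : ℕ → ℝ} {r : ℕ → ℕ} {R : ℝ} {N₀ : ℕ} (hR0 : 0 ≤ R)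
    (hR : ∀ j, 1 ≤ j → j ≤ N₀ → (r j : ℝ) ≤ R) (hε : ∀ j, 0 ≤ ε j) (h1 : ∀ j, 1 ≤ j → ‖v j‖ ≤ 1)
    (hv : ∀ j, 1 ≤ j → ‖v j‖ ≤
      max 0 (1 - ‖∑ i ∈ Finset.Icc 1 (j - r j), v i‖ / (2 * Real.sqrt j)) + ε j) :
    ∀ N ≤ N₀, ‖∑ i ∈ Finset.Icc 1 N, v i‖ ≤ 2 * Real.sqrt N + R + ∑ i ∈ Finset.Icc 1 N, ε i := by
  intro N
  induction N with
  | zero => intro _; simpa using hR0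
  | succ N ih =>
    intro hN
    have hεs : 0 ≤ ∑ i ∈ Finset.Icc 1 (N + 1), ε i := Finset.sum_nonneg fun i _ => hε i
    have hs : 0 < 2 * Real.sqrt (N + 1 : ℕ) := by positivity
    -- If the delayed sum is small, at most r(N+1) later terms of size 1 are added to it. Otherwise
    -- the new term is at most ε, and induction applies.
    by_cases hact : ‖∑ i ∈ Finset.Icc 1 (N + 1 - r (N + 1)), v i‖ < 2 * Real.sqrt (N + 1 : ℕ)
    · have hsplit : ∑ i ∈ Finset.Icc 1 (N + 1), v i =
          ∑ i ∈ Finset.Icc 1 (N + 1 - r (N + 1)), v i +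
            ∑ i ∈ Finset.Ioc (N + 1 - r (N + 1)) (N + 1), v i := by
        rw [← Finset.sum_union]
        · congr 1; ext i; simp only [Finset.mem_union, Finset.mem_Icc, Finset.mem_Ioc]; omega
        · rw [Finset.disjoint_left]
          intro i; simp only [Finset.mem_Icc, Finset.mem_Ioc]; omega
      have htail : ‖∑ i ∈ Finset.Ioc (N + 1 - r (N + 1)) (N + 1), v i‖ ≤ R := by
        refine (norm_sum_le_of_le _ (f := v) (n := fun _ => (1 : ℝ)) fun i hi =>
          h1 i (by have := (Finset.mem_Ioc.1 hi).1; omega)).trans ?_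
        rw [Finset.sum_const, Nat.card_Ioc, nsmul_eq_mul, mul_one]
        refine le_trans ?_ (hR (N + 1) (by omega) hN)
        exact_mod_cast (by omega : N + 1 - (N + 1 - r (N + 1)) ≤ r (N + 1))
      rw [hsplit]
      linarith [norm_add_le (∑ i ∈ Finset.Icc 1 (N + 1 - r (N + 1)), v i)
        (∑ i ∈ Finset.Ioc (N + 1 - r (N + 1)) (N + 1), v i)]
    · have h2 := hv (N + 1) (by omega)
      have h3 : 1 - ‖∑ i ∈ Finset.Icc 1 (N + 1 - r (N + 1)), v i‖ /
          (2 * Real.sqrt (N + 1 : ℕ)) ≤ 0 := by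
        rw [sub_nonpos, one_le_div hs]
        exact not_lt.1 hact
      rw [max_eq_left h3, zero_add] at h2
      rw [Finset.sum_Icc_succ_top (by omega), Finset.sum_Icc_succ_top (by omega)]
      have h4 := ih (by omega)
      have h5 : Real.sqrt N ≤ Real.sqrt (N + 1 : ℕ) := Real.sqrt_le_sqrt (by push_cast; linarith)
      linarith [norm_add_le (∑ i ∈ Finset.Icc 1 N, v i) (v (N + 1))]

/-! ### Lacunarity and the size of the delay -/

/-- Apply ln u ≤ u - 1 at u = √N/X, then 1/X ≤ ln q. -/
lemma logb_nat_le {q X : ℝ} (hq : 1 < q) (h1 : 1 / Real.log q ≤ X) (hX : 1 ≤ X) {N : ℕ}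
    (hN : 1 ≤ N) : Real.logb q N ≤ 2 * Real.sqrt N + 2 * Real.logb q X := by
  have hlq := Real.log_pos hq
  have hu : 0 < Real.sqrt N := Real.sqrt_pos.2 (by exact_mod_cast hN)
  have hX0 : 0 < X := by linarith
  have hlog : Real.log N = 2 * Real.log (Real.sqrt N) := by
    rw [Real.log_sqrt (Nat.cast_nonneg _)]; ring
  have h2 : Real.log (Real.sqrt N) ≤ Real.sqrt N / X + Real.log X := by
    have := Real.log_le_sub_one_of_pos (div_pos hu hX0)
    rw [Real.log_div hu.ne' hX0.ne'] at this
    linarith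
  have h3 : Real.sqrt N / X ≤ Real.sqrt N * Real.log q := by
    rw [div_le_iff₀ hX0, mul_assoc]
    refine le_mul_of_one_le_right hu.le ?_
    rw [div_le_iff₀ hlq] at h1
    linarith
  rw [Real.logb, Real.logb, hlog, div_le_iff₀ hlq, add_mul, mul_assoc 2 (_ / _),
    div_mul_cancel₀ _ hlq.ne']
  linarith

lemma lacunary_mul_pow_le {q : ℝ} {m : ℕ → ℕ} (hq : 0 ≤ q)
    (h : ∀ j, 1 ≤ j → q * m j ≤ m (j + 1)) {k : ℕ} (hk : 1 ≤ k) (i : ℕ) :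
    (m k : ℝ) * q ^ i ≤ m (k + i) := by
  induction i with
  | zero => simp
  | succ i ih =>
    calc (m k : ℝ) * q ^ (i + 1) = q * (m k * q ^ i) := by ring
      _ ≤ q * m (k + i) := by gcongr
      _ ≤ m (k + (i + 1)) := h _ (by omega)

lemma lacunary_sum_le {q : ℝ} {m : ℕ → ℕ} (hq : 1 < q)
    (h : ∀ j, 1 ≤ j → q * m j ≤ m (j + 1)) (k : ℕ) :
    (q - 1) * ∑ i ∈ Finset.Icc 1 k, (m (i + 1) : ℝ) ≤ q * m (k + 1) := by
  induction k with
  | zero => simp; positivity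
  | succ k ih =>
    rw [Finset.sum_Icc_succ_top (by omega), mul_add]
    nlinarith [h (k + 1) (by omega)]

/-- The logarithmic delay makes the approximation error of the `j`-th block `O(j⁻²)`. -/
lemma delay_error_le {q X μ μ' D A L : ℝ} {j r : ℕ} (hq : 1 < q) (hD : 0 < D) (hj : 1 ≤ j)
    (hX : X = max (max (μ / D) (1 / Real.log q)) 1)
    (hr : 2 * Real.logb q X + 2 * Real.logb q j ≤ r) (hμ : μ' * q ^ r ≤ μ)
    (hA : (q - 1) * A ≤ 2 * (q * μ')) (hL : L ≤ A / 2) (hμ0 : 0 ≤ μ') :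
    7 * L / D ≤ 14 / (j : ℝ) ^ 2 := by
  have hlq := Real.log_pos hq
  have hX1 : 1 ≤ X := hX ▸ le_max_right _ _
  have hX2 : μ / D ≤ X := hX ▸ (le_max_left _ _).trans (le_max_left _ _)
  have hX3 : 1 / Real.log q ≤ X := hX ▸ (le_max_right _ _).trans (le_max_left _ _)
  have hX0 : 0 < X := by linarith
  have hq0 : 0 < q := by linarith
  have hj0 : (0 : ℝ) < j := by exact_mod_cast hj
  have hpow : (X * j) ^ 2 ≤ q ^ r := by
    rw [← Real.rpow_natCast q r]
    have h1 : (X * j) ^ 2 = q ^ (2 * Real.logb q X + 2 * Real.logb q j) := by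
      rw [← mul_add, ← Real.logb_mul hX0.ne' hj0.ne', mul_comm 2, Real.rpow_mul hq0.le,
        Real.rpow_logb hq0 hq.ne' (by positivity)]
      norm_num
    rw [h1]
    exact Real.rpow_le_rpow_of_exponent_le hq.le hr
  -- Since ln q ≤ q - 1, X bounds 1/(q - 1), hence q/(q - 1) = 1 + 1/(q - 1) ≤ 2X.
  have hq1 : q ≤ 2 * X * (q - 1) := by
    have h1 : Real.log q ≤ q - 1 := Real.log_le_sub_one_of_pos hq0
    have h2 : 1 ≤ X * (q - 1) := by
      rw [div_le_iff₀ hlq] at hX3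
      nlinarith
    nlinarith
  have hL2 : L ≤ 2 * X * μ' := by
    have h1 : (q - 1) * L ≤ (q - 1) * (2 * X * μ') := by nlinarith
    exact le_of_mul_le_mul_left h1 (by linarith)
  have hμX : μ' * (X * j) ^ 2 ≤ X * D := by
    rw [div_le_iff₀ hD] at hX2
    nlinarith
  rw [div_le_div_iff₀ hD (by positivity)]
  have h5 : X * (μ' * X * j ^ 2) ≤ X * D := le_trans (le_of_eq (by ring)) hμX
  have h6 := le_of_mul_le_mul_left h5 hX0
  have h7 : L * (j : ℝ) ^ 2 ≤ 2 * X * μ' * (j : ℝ) ^ 2 := by gcongr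
  nlinarith

/-! ### The cutoff amplitude -/

/-- Amplitude attached to a partial sum `T`: it vanishes where `‖T‖ ≥ 2√j`. -/
noncomputable def cutoff (j : ℕ) (T : ℝ → ℂ) (x : ℝ) : ℝ := max 0 (1 - ‖T x‖ / (2 * Real.sqrt j))

lemma cutoff_nonneg (j : ℕ) (T : ℝ → ℂ) (x : ℝ) : 0 ≤ cutoff j T x := le_max_left _ _

lemma cutoff_le_one (j : ℕ) (T : ℝ → ℂ) (x : ℝ) : cutoff j T x ≤ 1 :=
  max_le zero_le_one (sub_le_self _ (by positivity))

lemma abs_cutoff_sub_le {j : ℕ} (hj : 1 ≤ j) {T : ℝ → ℂ} {A : ℝ} {x y D : ℝ} (hA : 0 ≤ A)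
    (hD : 0 ≤ D) (h : ‖T x - T y‖ ≤ A * D) : |cutoff j T x - cutoff j T y| ≤ A / 2 * D := by
  have hs : 1 ≤ Real.sqrt j := Real.one_le_sqrt.2 (by exact_mod_cast hj)
  calc |cutoff j T x - cutoff j T y|
      ≤ |(1 - ‖T x‖ / (2 * Real.sqrt j)) - (1 - ‖T y‖ / (2 * Real.sqrt j))| := by
        have := abs_max_sub_max_le_max 0 (1 - ‖T x‖ / (2 * Real.sqrt j)) 0
          (1 - ‖T y‖ / (2 * Real.sqrt j))
        simpa [cutoff] using this
    _ = |‖T x‖ - ‖T y‖| / (2 * Real.sqrt j) := by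
        rw [sub_sub_sub_cancel_left, ← sub_div, abs_div, abs_sub_comm,
          abs_of_pos (by positivity : 0 < 2 * Real.sqrt j)]
    _ ≤ (A * D) / 2 := by
        gcongr
        · exact (abs_norm_sub_norm_le _ _).trans h
        · linarith
    _ = A / 2 * D := by ring

/-- Use 1 - u ≥ 3/4 - u² with u = |T|/(2√j); the mean of u² is at most 1/4. -/
lemma half_le_gridMean_cutoff {M j : ℕ} (hM : 0 < M) (hj : 1 ≤ j) {T : ℝ → ℂ}
    (hT : gridMean M (fun t => ‖T t‖ ^ 2) ≤ j) : 1 / 2 ≤ gridMean M (cutoff j T) := by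
  have hj0 : (0 : ℝ) < j := by exact_mod_cast hj
  have key : ∀ t, 3 / 4 + -(1 / (4 * j : ℝ)) * ‖T t‖ ^ 2 ≤ cutoff j T t := by
    intro t
    refine le_trans ?_ (le_max_right _ _)
    have e : ‖T t‖ ^ 2 = (‖T t‖ / (2 * Real.sqrt j)) ^ 2 * (4 * j) := by
      have := Real.sq_sqrt hj0.le
      rw [div_pow, mul_pow, this]
      field_simp
      norm_num
    have e2 : -(1 / (4 * j : ℝ)) * ‖T t‖ ^ 2 = -(‖T t‖ / (2 * Real.sqrt j)) ^ 2 := by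
      rw [e]; field_simp
    rw [e2]
    nlinarith [sq_nonneg (‖T t‖ / (2 * Real.sqrt j) - 1 / 2)]
  refine le_trans ?_ (gridMean_mono key)
  rw [gridMean_add, gridMean_const hM, gridMean_const_mul]
  have : 1 / (4 * j : ℝ) * gridMean M (fun t => ‖T t‖ ^ 2) ≤ 1 / (4 * j : ℝ) * j := by gcongr
  have e : 1 / (4 * j : ℝ) * j = 1 / 4 := by field_simp
  linarith

/-! ### Assembly -/

theorem theorem1 :
    ∃ α β γ : ℝ, 0 < α ∧ 0 < β ∧ 0 < γ ∧
      ∀ (q : ℝ) (m d : ℕ → ℕ), 1 < q →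
        (∀ j : ℕ, 1 ≤ j → 0 < m j) →
        (∀ j : ℕ, 1 ≤ j → q ≤ (m (j + 1) : ℝ) / (m j : ℝ)) →
        (∀ j : ℕ, 1 ≤ j → 1 ≤ d j ∧ m j + d j ≤ m (j + 1)) →
        ∃ δ : ℕ → ℝ → ℂ,
          (∀ j : ℕ, 1 ≤ j → IsTrigPolyOn (m j) (d j) (δ j)) ∧
          (∀ j : ℕ, 1 ≤ j →
            1 / 8 ≤ eLpNorm (δ j) 1 circleMeasure ∧
            eLpNorm (δ j) 1 circleMeasure ≤ eLpNorm (δ j) ⊤ circleMeasure ∧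
            eLpNorm (δ j) ⊤ circleMeasure ≤ 7) ∧
          (∀ (N : ℕ) (hN : 1 ≤ N),
            eLpNorm (fun x : ℝ => ∑ j ∈ Finset.Icc 1 N, δ j x) ⊤ circleMeasure ≤
              ENNReal.ofReal (α + β * Real.sqrt (N : ℝ) +
                γ * (Finset.Icc 1 N).sup' (Finset.nonempty_Icc.mpr hN) (fun j : ℕ =>
                  Real.logb q
                    (max (max ((m j : ℝ) / (d j : ℝ)) (1 / Real.log q)) 1)))) := by
  -- With B the maximum in the claim, the total is 2√N, plus the delay bound 2 + 2B + 2(2√N + 2B),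
  -- plus 28 from the errors 14/j².
  refine ⟨30, 6, 6, by norm_num, by norm_num, by norm_num, ?_⟩
  intro q m d hq hm hratio hd
  have hlac : ∀ j, 1 ≤ j → q * m j ≤ m (j + 1) := fun j hj =>
    (le_div_iff₀ (by exact_mod_cast hm j hj)).1 (hratio j hj)
  have hmono : ∀ i j, 1 ≤ i → i ≤ j → m i ≤ m j := by
    intro i j hi hij
    induction j, hij using Nat.le_induction with
    | base => exact le_rfl
    | succ j hj ih => have := (hd j (by omega)).2; omega
  set X : ℕ → ℝ := fun j => max (max ((m j : ℝ) / (d j : ℝ)) (1 / Real.log q)) 1 with hX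
  set s : ℕ → ℕ := fun j => ⌈2 * Real.logb q (X j) + 2 * Real.logb q j⌉₊ with hs
  -- The extra 1 makes the recursion strict, and `j - r j + 1 + s j = j` when r j < j: S_{j - r j}
  -- has frequencies below m at index j - r j + 1, which lies s j steps before j.
  set r : ℕ → ℕ := fun j => s j + 1 with hr
  have hblock : ∀ (j : ℕ) (T : ℝ → ℂ), ∃ g : ℝ → ℂ, 1 ≤ j →
      IsTrigPolyOn (m j) (d j) g ∧ (∀ x, ‖g x‖ ≤ 1) ∧
      (∀ x y : ℝ, ‖g x - g y‖ ≤
        (m j + 2 * d j) * ‖Complex.exp (Complex.I * x) - Complex.exp (Complex.I * y)‖) ∧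
      ENNReal.ofReal (gridMean (m j + d j) (cutoff j T)) ≤ eLpNorm g 1 circleMeasure ∧
      ∀ L : ℝ, 0 ≤ L → (∀ x, cutoff j T (-x) = cutoff j T x) →
        (∀ x y : ℝ, |cutoff j T x - cutoff j T y| ≤
          L * ‖Complex.exp (Complex.I * x) - Complex.exp (Complex.I * y)‖) →
        ∀ x, ‖g x‖ ≤ cutoff j T x + 7 * L / d j := by
    intro j T
    by_cases hj : 1 ≤ j
    · obtain ⟨g, hg⟩ := exists_block (hm j hj) (hd j hj).1 (cutoff_nonneg j T) (cutoff_le_one j T)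
      exact ⟨g, fun _ => hg⟩
    · exact ⟨0, fun h => absurd h hj⟩
  choose G hG using hblock
  set δ := delayedSeq G r with hδ
  set S : ℕ → ℝ → ℂ := fun k x => ∑ i ∈ Finset.Icc 1 k, δ i x with hS
  have hδeq (j : ℕ) : δ j = G j (S (j - r j)) := delayedSeq_eq G (fun j => by simp [hr]) j
  have hSsucc (k : ℕ) : S (k + 1) = fun x => S k x + δ (k + 1) x := by
    funext x; exact Finset.sum_Icc_succ_top (by omega) _
  have hblk (j : ℕ) (hj : 1 ≤ j) := hG j (S (j - r j)) hj
  simp only [← hδeq] at hblk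
  have hpoly (j : ℕ) (hj : 1 ≤ j) : IsTrigPolyOn (m j) (d j) (δ j) := (hblk j hj).1
  have hone (j : ℕ) (hj : 1 ≤ j) : ∀ x, ‖δ j x‖ ≤ 1 := (hblk j hj).2.1
  have hSpoly (k : ℕ) : IsTrigPolyOn 0 (m (k + 1)) (S k) := by
    refine IsTrigPolyOn.sum fun i hi => ?_
    rw [Finset.mem_Icc] at hi
    refine (hpoly i hi.1).mono (Nat.zero_le _) ?_
    have h1 := (hd i hi.1).2
    have h2 := hmono (i + 1) (k + 1) (by omega) (by omega)
    omega
  have hSmean (M : ℕ) : ∀ k, m (k + 1) ≤ M → gridMean M (fun t => ‖S k t‖ ^ 2) ≤ k := by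
    intro k
    induction k with
    | zero => simp [hS, gridMean]
    | succ k ih =>
      intro hk
      have h1 := hd (k + 1) (by omega)
      have hM : 0 < M := (hm (k + 1 + 1) (by omega)).trans_le hk
      have h2 : gridMean M (fun t => ‖δ (k + 1) t‖ ^ 2) ≤ 1 := by
        rw [← gridMean_const hM 1]
        exact gridMean_mono fun t => pow_le_one₀ (norm_nonneg _) (hone (k + 1) (by omega) t)
      rw [hSsucc, gridMean_norm_sq_add hM (by omega) (hSpoly k)
        ((hpoly (k + 1) (by omega)).mono le_rfl (by omega))]
      push_cast
      exact add_le_add (ih (by omega)) h2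
  have hSlip (k : ℕ) (x y : ℝ) : ‖S k x - S k y‖ ≤ (∑ i ∈ Finset.Icc 1 k, (m i + 2 * d i : ℝ)) *
      ‖Complex.exp (Complex.I * x) - Complex.exp (Complex.I * y)‖ := by
    simp only [hS]
    rw [← Finset.sum_sub_distrib, Finset.sum_mul]
    exact norm_sum_le_of_le _ fun i hi => (hblk i (Finset.mem_Icc.1 hi).1).2.2.1 x y
  have hsmall (j : ℕ) (hj : 1 ≤ j) (x : ℝ) :
      ‖δ j x‖ ≤ cutoff j (S (j - r j)) x + 14 / (j : ℝ) ^ 2 := by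
    set A := ∑ i ∈ Finset.Icc 1 (j - r j), (m i + 2 * d i : ℝ) with hA
    have hA0 : 0 ≤ A := Finset.sum_nonneg fun i _ => by positivity
    have h1 := (hblk j hj).2.2.2.2 (A / 2) (by positivity)
      (fun x => by rw [cutoff, cutoff, (hSpoly _).conj, RCLike.norm_conj])
      (fun x y => abs_cutoff_sub_le hj hA0 (norm_nonneg _) (hSlip _ x y)) x
    have hd0 : (0 : ℝ) < d j := by exact_mod_cast (hd j hj).1
    refine h1.trans (add_le_add le_rfl ?_)
    -- If the delay reaches back past the start, the partial sum is empty and the smoothing error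
    -- vanishes.
    rcases Nat.eq_zero_or_pos (j - r j) with h0 | hpos
    · have : A = 0 := by rw [hA, h0]; simp
      rw [this]
      simp only [zero_div, mul_zero]
      positivity
    · have hA2 : A ≤ 2 * ∑ i ∈ Finset.Icc 1 (j - r j), (m (i + 1) : ℝ) := by
        rw [hA, Finset.mul_sum]
        refine Finset.sum_le_sum fun i hi => ?_
        have : m i + 2 * d i ≤ 2 * m (i + 1) := by
          have := (hd i (Finset.mem_Icc.1 hi).1).2
          omega
        exact_mod_cast this
      have h2 := lacunary_mul_pow_le (by linarith) hlac (k := j - r j + 1) (by omega) (s j)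
      have h3 : j - r j + 1 + s j = j := by simp only [hr] at hpos ⊢; omega
      rw [h3] at h2
      have h4 := lacunary_sum_le hq hlac (j - r j)
      exact delay_error_le hq hd0 hj rfl (Nat.le_ceil _) h2 (by nlinarith) le_rfl
        (Nat.cast_nonneg _)
  refine ⟨δ, hpoly, fun j hj => ⟨?_, ?_, ?_⟩, fun N hN => ?_⟩
  · have h1 := hd j hj
    have h2 := hmono (j - r j + 1) j (by omega) (by simp only [hr]; omega)
    have h3 : gridMean (m j + d j) (fun t => ‖S (j - r j) t‖ ^ 2) ≤ j :=
      (hSmean _ (j - r j) (by omega)).trans (by exact_mod_cast Nat.sub_le _ _)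
    have h4 := half_le_gridMean_cutoff (by omega) hj h3
    refine le_trans ?_ (hblk j hj).2.2.2.1
    refine le_trans ?_ (ENNReal.ofReal_le_ofReal h4)
    rw [ENNReal.ofReal_div_of_pos two_pos]
    simp only [ENNReal.ofReal_one, ENNReal.ofReal_ofNat]
    gcongr
    norm_num
  · exact eLpNorm_le_eLpNorm_of_exponent_le le_top (hpoly j hj).continuous.aestronglyMeasurable
  · refine (eLpNorm_top_circleMeasure_le (hone j hj)).trans ?_
    rw [ENNReal.ofReal_one]
    norm_num
  · refine eLpNorm_top_circleMeasure_le fun x => ?_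
    set B := (Finset.Icc 1 N).sup' (Finset.nonempty_Icc.mpr hN) (fun j : ℕ => Real.logb q
      (max (max ((m j : ℝ) / (d j : ℝ)) (1 / Real.log q)) 1)) with hB
    have hX1 (j : ℕ) : 1 ≤ X j := le_max_right _ _
    have hXlog (j : ℕ) : 0 ≤ Real.logb q (X j) := Real.logb_nonneg hq (hX1 j)
    have hXB (j : ℕ) (h1 : 1 ≤ j) (h2 : j ≤ N) : Real.logb q (X j) ≤ B :=
      Finset.le_sup' (fun j : ℕ => Real.logb q (X j)) (Finset.mem_Icc.2 ⟨h1, h2⟩)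
    have hB0 : 0 ≤ B := (hXlog 1).trans (hXB 1 le_rfl hN)
    have hNlog : Real.logb q N ≤ 2 * Real.sqrt N + 2 * B :=
      (logb_nat_le hq ((le_max_right _ _).trans (le_max_left _ _)) (hX1 1) hN).trans
        (by linarith [hXB 1 le_rfl hN])
    have hR (j : ℕ) (h1 : 1 ≤ j) (h2 : j ≤ N) :
        (r j : ℝ) ≤ 2 + 2 * B + 2 * (2 * Real.sqrt N + 2 * B) := by
      have hj1 : (1 : ℝ) ≤ j := by exact_mod_cast h1
      have h3 : Real.logb q j ≤ Real.logb q N :=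
        Real.logb_le_logb_of_le hq (by linarith) (by exact_mod_cast h2)
      have h4 : 0 ≤ Real.logb q j := Real.logb_nonneg hq hj1
      have h5 := Nat.ceil_lt_add_one
        (show 0 ≤ 2 * Real.logb q (X j) + 2 * Real.logb q j by linarith [hXlog j])
      simp only [hr, hs]
      push_cast
      linarith [hXB j h1 h2]
    have h := norm_sum_le_of_delayed (v := fun j => δ j x) (ε := fun j => 14 / (j : ℝ) ^ 2)
      (by positivity) hR (fun j => by positivity) (fun j hj => hone j hj x)
      (fun j hj => hsmall j hj x) N le_rfl
    linarith [sum_inv_sq_le 14 (by norm_num) N]
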